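/- Let $k>0$. A set $E$ in a metric space $\mathbb X$ is *$k$-Ahlfors-David regular with constant $C>1$* if it is closed, has more than one point, and for all $x\in E$ $$C^{-1}r^k<\mathcal H^k(E\cap B(x,r))\ \text{ for } 0<r<\operatorname{diam}E,\qquad \mathcal H^k(E\cap B(x,r))<Cr^k\ \text{ for all } r>0 ,$$ where $\mathcal H^k$ is the $k$-dimensional Hausdorff measure and $B(x,r)$ the open ball. For a class $\mathcal G$ of subsets of $\mathbb X$ and constants $c=(C,\theta)$ with $C>1$, $\theta>0$, let $\mathrm{BP}_c(\mathcal G)$ be the class of all $E\subseteq\mathbb X$ that are $k$-Ahlfors-David regular with constant $C$ and such that for every $x\in E$ and $R>0$ there is $G\in\mathcal G$ with $$\mathcal H^k(B(x,R)\cap E\cap G)\ \ge\ \theta\,\mathcal H^k(B(x,R)\cap E).$$ For $c=(c_1,\dots,c_j)$, $c_i=(C_i,\theta_i)$, put $\mathrm{BP}^j_c(\mathcal F)=\mathrm{BP}_{c_1}(\mathrm{BP}_{c_2}(\cdots\mathrm{BP}_{c_j}(\mathcal F)))$. **Corollary.** For every $j>2$ and every class $\mathcal F$ of closed $k$-Ahlfors-David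 regular subsets of a metric space $\mathbb X$ (the regularity constant may vary with the member of $\mathcal F$), $$\mathrm{BP}^j(\mathcal F)=\mathrm{BP}(\mathrm{BP}(\mathcal F)),$$ where a set belongs to the left (right) side if it belongs to $\mathrm{BP}^j_c(\mathcal F)$ (to $\mathrm{BP}_{c'_1}(\mathrm{BP}_{c'_2}(\mathcal F))$) for some choice of the constants. Quantitatively, and with constants that depend only on $k$, $j$ and the given constants, not on $\mathbb X$ or $\mathcal F$: 1. for all $c=(c_1,\dots,c_j)$ there are $c'_1,c'_2$ such that $\mathrm{BP}^j_c(\mathcal F)\subseteq \mathrm{BP}_{c'_1}(\mathrm{BP}_{c'_2}(\mathcal F))$; 2. for all $c'_1,c'_2$ there is $c=(c_1,\dots,c_j)$ such that $\mathrm{BP}_{c'_1}(\mathrm{BP}_{c'_2}(\mathcal F))\subseteq \mathrm{BP}^j_c(\mathcal F)$; 3. for all $c=(c_1,\dots,c_j)$ with $\theta_1,\dots,\theta_j\le 1$ there are $c''_1,c''_2$ with $\theta''_1,\theta''_2\le1$ such that $\mathrm{BP}_{c''_1}(\mathrm{BP}_{c''_2}(\mathcal F))\subseteq \mathrm{BP}^j_c(\mathcal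 F)$. -/

import Mathlib

open MeasureTheory Metric Set
open scoped ENNReal

universe u

/-- `E` is closed, has more than one point, and is `k`-Ahlfors-David regular with constant `C`:
the lower bound `C⁻¹ r ^ k < ℋᵏ(E ∩ B(x, r))` for `0 < r < diam E` (all `r > 0` if `E` is
unbounded), the upper bound `ℋᵏ(E ∩ B(x, r)) < C r ^ k` for all `r > 0`. -/
structure IsADRWith {X : Type*} [MetricSpace X] [MeasurableSpace X] [BorelSpace X]
    (k C : ℝ) (E : Set X) : Prop where
  isClosed : IsClosed E
  nontrivial : E.Nontrivial
  lower : ∀ x ∈ E, ∀ r : ℝ, 0 < r → ENNReal.ofReal r < ediam E →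
    ENNReal.ofReal (C⁻¹ * r ^ k) < Measure.hausdorffMeasure k (E ∩ ball x r)
  upper : ∀ x ∈ E, ∀ r : ℝ, 0 < r →
    Measure.hausdorffMeasure k (E ∩ ball x r) < ENNReal.ofReal (C * r ^ k)

/-- `E` is a closed `k`-Ahlfors-David regular set. -/
def IsADR {X : Type*} [MetricSpace X] [MeasurableSpace X] [BorelSpace X]
    (k : ℝ) (E : Set X) : Prop :=
  ∃ C : ℝ, 1 < C ∧ IsADRWith k C E

/-- The constants of one application of the big-pieces operator: a regularity constant `C > 1`
and a big-piece fraction `θ > 0`. -/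
structure BPConst where
  C : ℝ
  θ : ℝ
  one_lt_C : 1 < C
  θ_pos : 0 < θ

/-- The class `BP(𝓕)` with constants `c = (C, θ)`: the closed sets `E` that are `k`-Ahlfors-David
regular with constant `C` and such that for all `x ∈ E` and `R > 0` some `G ∈ 𝓕` satisfies
`ℋᵏ(B(x, R) ∩ E ∩ G) ≥ θ ℋᵏ(B(x, R) ∩ E)`. -/
def BP {X : Type*} [MetricSpace X] [MeasurableSpace X] [BorelSpace X]
    (k : ℝ) (c : BPConst) (𝓕 : Set (Set X)) : Set (Set X) :=
  {E | IsADRWith k c.C E ∧ ∀ x ∈ E, ∀ R : ℝ, 0 < R → ∃ G ∈ 𝓕,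
    ENNReal.ofReal c.θ * Measure.hausdorffMeasure k (ball x R ∩ E) ≤
      Measure.hausdorffMeasure k (ball x R ∩ E ∩ G)}

/-- The iterated class `BPʲ(𝓕) = BP(BP(⋯ BP(𝓕)))` with constants `c 0, …, c (j - 1)`, where `c 0`
belongs to the outermost operator. -/
def BPIter {X : Type*} [MetricSpace X] [MeasurableSpace X] [BorelSpace X]
    (k : ℝ) : (j : ℕ) → (Fin j → BPConst) → Set (Set X) → Set (Set X)
  | 0, _, 𝓕 => 𝓕
  | j + 1, c, 𝓕 => BP k (c 0) (BPIter k j (fun i => c i.succ) 𝓕)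

/-! ### Regularity conditions, truncation and packing -/

section RegularSets

variable {X : Type*} [MetricSpace X] [MeasurableSpace X]

/-! Everything rests on reducing three operators to two (`exists_BP_BP_BP_subset`); iterating this
collapses any longer chain. The reverse inclusion is padding: when `θ ≤ 1`, a regular set is a big
piece of itself.

Let `E` be in the triple class. In a given ball, `E` shares a fixed proportion of its mass with some
`H` whose own balls contain big pieces of members of `BP(𝓕)`. It suffices to find one `G` in `BP(𝓕)`
that contains all of `H` near the ball up to a small proportion `η`: then `G` keeps half of what `H`
captured.

Such a `G` is grown greedily. Start with a truncated piece. Cover the part of `H` off `G` by Whitney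
balls of radius `infDist p G / 10`, and attach to `G` a truncated piece in each ball of a disjoint
subfamily (`exists_whitney_extension`). The Whitney geometry keeps the union closed, upper regular
and rich in pieces of `𝓕`, with worse constants, and the mass captured from `H` grows by a fixed
fraction of what was missing. That mass is bounded, so a number of steps depending only on the
constants leaves at most `η r ^ k` (`exists_approximation`). Lower regularity of `G` is automatic,
since big pieces carry mass (`mem_BP_of_hasBigPieces`). -/

/-- `μ(B(x, r) ∩ G) ≤ b r ^ k` for all balls, centred on `G` or not. -/
def UpperRegular (μ : Measure X) (k b : ℝ) (G : Set X) : Prop :=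
  ∀ x : X, ∀ r : ℝ, 0 < r → μ (ball x r ∩ G) ≤ ENNReal.ofReal (b * r ^ k)

/-- `μ(B(x, r) ∩ G) ≥ a r ^ k` for all balls of radius at most `R` centred on `G`. -/
def LowerRegular (μ : Measure X) (k a R : ℝ) (G : Set X) : Prop :=
  ∀ x ∈ G, ∀ r : ℝ, 0 < r → r ≤ R → ENNReal.ofReal (a * r ^ k) ≤ μ (ball x r ∩ G)

/-- Every ball of radius `ρ ≤ R` centred on `G` contains a part of `G` of measure at least
`δ ρ ^ k` that lies in a single member of `𝓕`. -/
def HasBigPieces (μ : Measure X) (k δ R : ℝ) (𝓕 : Set (Set X)) (G : Set X) : Prop :=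
  ∀ z ∈ G, ∀ ρ : ℝ, 0 < ρ → ρ ≤ R → ∃ F ∈ 𝓕, ENNReal.ofReal (δ * ρ ^ k) ≤ μ (ball z ρ ∩ G ∩ F)

variable {μ : Measure X} {k : ℝ} {𝓕 : Set (Set X)}

theorem UpperRegular.mono {b : ℝ} {G T : Set X} (h : UpperRegular μ k b G) (hT : T ⊆ G) :
    UpperRegular μ k b T := fun x r hr =>
  (measure_mono (inter_subset_inter_right _ hT)).trans (h x r hr)

/-- A closed truncation of `E` to a ball that keeps big pieces up to its boundary. -/
theorem exists_truncation {δ s : ℝ} (hs : 0 < s) {E : Set X}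
    (hE : IsClosed E) (hP : HasBigPieces μ k δ s 𝓕 E) (y : X) :
    ∃ T : Set X, IsClosed T ∧ T ⊆ E ∧ T ⊆ closedBall y (2 * s) ∧ ball y s ∩ E ⊆ T ∧
      HasBigPieces μ k (δ / 16 ^ k) s 𝓕 T := by
  -- Cutting `E` by a ball may leave boundary points with almost no mass nearby. Instead the cut is
  -- fattened inside `E` by `s / 2`, `s / 4`, …, so that each stage has room in the next one while
  -- the total growth stays below `s`.
  obtain ⟨U, hU0, hUs⟩ : ∃ U : ℕ → Set X, U 0 = ball y s ∩ E ∧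
      ∀ n, U (n + 1) = {z | z ∈ E ∧ ∃ w ∈ U n, dist z w < s * (1 / 2) ^ (n + 1)} :=
    ⟨fun n => Nat.rec (ball y s ∩ E)
      (fun n V => {z | z ∈ E ∧ ∃ w ∈ V, dist z w < s * (1 / 2) ^ (n + 1)}) n, rfl, fun _ => rfl⟩
  have hUE : ∀ n, U n ⊆ E := by
    rintro (_ | n)
    · exact hU0 ▸ inter_subset_right
    · rw [hUs]; exact fun z hz => hz.1
  have hUmono : Monotone U := by
    refine monotone_nat_of_le_succ fun n z hz => ?_
    rw [hUs]
    exact ⟨hUE n hz, z, hz, by rw [dist_self]; positivity⟩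
  have hUball : ∀ n, ∀ z ∈ U n, dist z y < 2 * s - s * (1 / 2) ^ n := by
    intro n
    induction n with
    | zero => intro z hz; rw [hU0] at hz; have := mem_ball.1 hz.1; norm_num; linarith
    | succ n ih =>
      intro z hz
      rw [hUs] at hz
      obtain ⟨-, w, hw, hzw⟩ := hz
      have h1 := ih w hw
      have h2 := dist_triangle z w y
      rw [pow_succ] at hzw ⊢
      linarith
  have hchain : ∀ n m, ∀ z ∈ U (n + m), ∃ w ∈ U n,
      dist z w ≤ s * (1 / 2) ^ n - s * (1 / 2) ^ (n + m) := by
    intro n m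
    induction m with
    | zero => intro z hz; exact ⟨z, hz, by simp⟩
    | succ m ih =>
      intro z hz
      rw [← add_assoc, hUs] at hz
      obtain ⟨-, v, hv, hzv⟩ := hz
      obtain ⟨w, hw, hvw⟩ := ih v hv
      refine ⟨w, hw, ?_⟩
      have h2 := dist_triangle z v w
      rw [← add_assoc]
      rw [pow_succ] at hzv ⊢
      linarith
  refine ⟨closure (⋃ n, U n), isClosed_closure, ?_, ?_, ?_, ?_⟩
  · exact closure_minimal (iUnion_subset hUE) hE
  · refine closure_minimal (iUnion_subset fun n z hz => ?_) isClosed_closedBall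
    have := hUball n z hz
    have h0 : 0 < s * (1 / 2 : ℝ) ^ n := by positivity
    exact mem_closedBall.2 (by linarith)
  · exact fun z hz => subset_closure (mem_iUnion.2 ⟨0, hU0 ▸ hz⟩)
  · intro z hz ρ hρ hρs
    obtain ⟨z', hz', hzz'⟩ := Metric.mem_closure_iff.1 hz (ρ / 2) (by linarith)
    obtain ⟨N, hN⟩ := mem_iUnion.1 hz'
    -- The stage `n` satisfies `s / 2 ^ (n + 1) < ρ / 4 ≤ s / 2 ^ n`: stage `n + 1` comes within `ρ
    -- / 4` of `z'`, and the `ρ / 16`-ball of `E` around any of its points lies in stage `n + 2`.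
    obtain ⟨n, hn1, hn2⟩ := exists_nat_pow_near_of_lt_one (x := ρ / (4 * s)) (y := (1 / 2 : ℝ))
      (by positivity) (by rw [div_le_one (by positivity)]; linarith) (by norm_num) (by norm_num)
    rw [lt_div_iff₀ (by positivity)] at hn1
    rw [div_le_iff₀ (by positivity)] at hn2
    have hw : ∃ w ∈ U (n + 1), dist z' w ≤ s * (1 / 2) ^ (n + 1) := by
      rcases le_total N (n + 1) with h | h
      · exact ⟨z', hUmono h hN, by rw [dist_self]; positivity⟩
      · obtain ⟨m, rfl⟩ := Nat.exists_eq_add_of_le h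
        obtain ⟨w, hw, hd⟩ := hchain (n + 1) m z' hN
        exact ⟨w, hw, hd.trans (sub_le_self _ (by positivity))⟩
    obtain ⟨w, hw, hzw⟩ := hw
    obtain ⟨F, hF, hFw⟩ := hP w (hUE (n + 1) hw) (ρ / 16) (by linarith) (by linarith)
    refine ⟨F, hF, le_trans (le_of_eq ?_) (hFw.trans (measure_mono ?_))⟩
    · rw [Real.div_rpow hρ.le (by norm_num)]
      congr 1; ring
    · refine inter_subset_inter_left F fun x hx => ?_
      have hxw := mem_ball.1 hx.1
      have hxU : x ∈ U (n + 1 + 1) := by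
        rw [hUs]
        refine ⟨hx.2, w, hw, hxw.trans_le ?_⟩
        rw [pow_add, pow_add]; linarith
      refine ⟨mem_ball.2 ?_, subset_closure (mem_iUnion.2 ⟨_, hxU⟩)⟩
      have h1 := dist_triangle x w z
      have h2 := dist_triangle w z' z
      rw [dist_comm w z', dist_comm z' z] at h2
      linarith

variable [BorelSpace X]

/-- Disjoint balls centred on a regular set and contained in one ball: the packing estimate. -/
theorem tsum_le_of_packing {a b r L : ℝ} {H J : Set X} {s : X → ℝ} (hH : IsClosed H)
    (hl : LowerRegular μ k a r H) (hu : UpperRegular μ k b H) (hJH : J ⊆ H)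
    (hs : ∀ p ∈ J, 0 < s p ∧ s p ≤ r) (hd : J.PairwiseDisjoint fun p => ball p (s p)) {z : X}
    (hL : 0 < L) (hJL : ∀ p ∈ J, ball p (s p) ⊆ ball z L) :
    ∑' p : J, ENNReal.ofReal (a * s p ^ k) ≤ ENNReal.ofReal (b * L ^ k) := by
  calc ∑' p : J, ENNReal.ofReal (a * s p ^ k) ≤ ∑' p : J, μ (ball (p : X) (s p) ∩ H) :=
        ENNReal.tsum_le_tsum fun p => hl p (hJH p.2) _ (hs p p.2).1 (hs p p.2).2
    _ ≤ μ (⋃ p : J, ball (p : X) (s p) ∩ H) := by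
        refine tsum_meas_le_meas_iUnion_of_disjoint μ
          (fun p => isOpen_ball.measurableSet.inter hH.measurableSet) fun p q hpq => ?_
        exact (hd p.2 q.2 (fun h => hpq (Subtype.ext h))).mono inter_subset_left inter_subset_left
    _ ≤ μ (ball z L ∩ H) := measure_mono <| iUnion_subset fun p =>
        inter_subset_inter_left _ (hJL p p.2)
    _ ≤ _ := hu z L hL

/-- Each `A p` is charged to its ball, whose `H`-mass is at least `a * s p ^ k`; the packing
estimate bounds the total charge. -/
theorem measure_biUnion_le_of_packing {a b r L κ : ℝ} {H J : Set X} {s : X → ℝ} (ha : 0 < a)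
    (hκ : 0 ≤ κ) (hH : IsClosed H)
    (hl : LowerRegular μ k a r H) (hu : UpperRegular μ k b H) (hJH : J ⊆ H)
    (hs : ∀ p ∈ J, 0 < s p ∧ s p ≤ r) (hd : J.PairwiseDisjoint fun p => ball p (s p)) {z : X}
    (hL : 0 < L) (hJL : ∀ p ∈ J, ball p (s p) ⊆ ball z L) (hJ : J.Countable) {A : X → Set X}
    (hA : ∀ p ∈ J, μ (A p) ≤ ENNReal.ofReal (κ * s p ^ k)) :
    μ (⋃ p ∈ J, A p) ≤ ENNReal.ofReal (κ / a * (b * L ^ k)) := by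
  calc μ (⋃ p ∈ J, A p) ≤ ∑' p : J, μ (A p) := measure_biUnion_le μ hJ A
    _ ≤ ∑' p : J, ENNReal.ofReal (κ / a) * ENNReal.ofReal (a * s p ^ k) := by
        refine ENNReal.tsum_le_tsum fun p => (hA p p.2).trans (le_of_eq ?_)
        rw [← ENNReal.ofReal_mul (by positivity)]
        congr 1; field_simp
    _ ≤ ENNReal.ofReal (κ / a) * ENNReal.ofReal (b * L ^ k) := by
        rw [ENNReal.tsum_mul_left]
        exact mul_le_mul_right (tsum_le_of_packing hH hl hu hJH hs hd hL hJL) _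
    _ = _ := (ENNReal.ofReal_mul (by positivity)).symm

end RegularSets

/-! ### Whitney extension of a set by pieces off it -/

section Whitney

variable {X : Type*} [MetricSpace X]

/-- If a ball of radius at most `s` meets the double of a Whitney ball of radius `s`, then its
centre is at a distance comparable to `s` from `G`. -/
theorem infDist_mem_Icc_of_whitney {G : Set X} {p q z : X} {ρ : ℝ}
    (hq : q ∈ closedBall p (2 * (infDist p G / 10))) (hqz : q ∈ ball z ρ)
    (hρ : ρ ≤ infDist p G / 10) :
    dist p z < 3 * (infDist p G / 10) ∧ 7 * (infDist p G / 10) < infDist z G ∧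
      infDist z G < 13 * (infDist p G / 10) := by
  have h1 := mem_closedBall.1 hq
  have h2 := mem_ball.1 hqz
  have h3 := dist_triangle p q z
  rw [dist_comm p q] at h3
  have h4 : infDist p G ≤ infDist z G + dist p z := infDist_le_infDist_add_dist
  have h5 : infDist z G ≤ infDist p G + dist z p := infDist_le_infDist_add_dist
  rw [dist_comm z p] at h5
  exact ⟨by linarith, by linarith, by linarith⟩

variable [MeasurableSpace X] [BorelSpace X] {μ : Measure X} {k : ℝ} {𝓕 : Set (Set X)}

/-- A disjoint subfamily of the Whitney balls of the points of `P` off the closed set `G`. -/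
theorem exists_whitney_balls {a b r : ℝ} (ha : 0 < a) {H G P : Set X} {y : X}
    (hH : IsClosed H) (hl : LowerRegular μ k a r H) (hu : UpperRegular μ k b H) (hr : 0 < r)
    (hPH : P ⊆ H) (hPy : P ⊆ ball y r)
    (hd : ∀ p ∈ P, 0 < infDist p G ∧ infDist p G < 2 * r) :
    ∃ u ⊆ P, u.Countable ∧ (u.PairwiseDisjoint fun p => ball p (infDist p G / 10)) ∧
      ∀ p ∈ P, ∃ q ∈ u, p ∈ ball q (5 * (infDist q G / 10)) := by
  obtain ⟨u, huP, hdisj, hcov⟩ := Vitali.exists_disjoint_subfamily_covering_enlargement_closedBall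
    P id (fun p => infDist p G / 10) r (fun p hp => by linarith [(hd p hp).2]) 4 (by norm_num)
  have hdisj' : u.PairwiseDisjoint fun p => ball p (infDist p G / 10) :=
    fun p hp q hq hpq => (hdisj hp hq hpq).mono ball_subset_closedBall ball_subset_closedBall
  have hs : ∀ p ∈ u, 0 < infDist p G / 10 ∧ infDist p G / 10 ≤ r := fun p hp =>
    ⟨by linarith [(hd p (huP hp)).1], by linarith [(hd p (huP hp)).2]⟩
  refine ⟨u, huP, ?_, hdisj', fun p hp => ?_⟩
  -- `X` need not be separable; countability holds because a convergent sum has countably many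
  -- nonzero terms, and here all terms are positive.
  · have hfin := ne_top_of_le_ne_top ENNReal.ofReal_ne_top
      (tsum_le_of_packing hH hl hu (huP.trans hPH) hs hdisj' (z := y) (L := 2 * r) (by linarith)
      fun p hp => ball_subset_ball' (by
        linarith [(hd p (huP hp)).2, mem_ball.1 (hPy (huP hp))]))
    have hc := Summable.countable_support_ennreal hfin
    have huniv : Function.support (fun p : u => ENNReal.ofReal (a * (infDist (p : X) G / 10) ^ k))
        = univ := by
      refine eq_univ_of_forall fun p => ?_
      have := (hs p p.2).1
      exact (ENNReal.ofReal_pos.2 (by positivity)).ne'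
    rw [huniv, countable_univ_iff] at hc
    exact countable_coe_iff.1 hc
  · obtain ⟨q, hq, hpq⟩ := hcov p hp
    have h1 := mem_closedBall.1 (hpq (mem_closedBall_self (by linarith [(hd p hp).1])))
    have h2 := (hs q hq).1
    exact ⟨q, hq, mem_ball.2 (h1.trans_lt (by linarith))⟩

/-- Sets attached to the Whitney balls: their union is upper regular. -/
theorem upperRegular_biUnion_whitney (hk : 0 < k) {a b b' r : ℝ} (ha : 0 < a) (hb' : 0 ≤ b')
    (hb : 0 ≤ b) {H G u : Set X} {T : X → Set X} (hH : IsClosed H)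
    (hl : LowerRegular μ k a r H) (hu : UpperRegular μ k b H) (huH : u ⊆ H)
    (hd : ∀ p ∈ u, 0 < infDist p G ∧ infDist p G / 10 ≤ r) (huc : u.Countable)
    (hdisj : u.PairwiseDisjoint fun p => ball p (infDist p G / 10))
    (hT : ∀ p ∈ u, T p ⊆ closedBall p (2 * (infDist p G / 10)))
    (hTu : ∀ p ∈ u, UpperRegular μ k b' (T p)) :
    UpperRegular μ k (2 * 13 ^ k * b' * b / a) (⋃ p ∈ u, T p) := by
  intro z ρ hρ
  set D := infDist z G with hD
  -- Large Whitney balls have radius comparable to `D`, so boundedly many matter, each contributing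
  -- at most `b' * ρ ^ k`. Small ones lie in `ball z (4 * ρ)`, where their masses are summed.
  let J₁ : Set X := {p | p ∈ u ∧ ρ ≤ infDist p G / 10 ∧ (ball z ρ ∩ T p).Nonempty}
  let J₂ : Set X := {p | p ∈ u ∧ infDist p G / 10 < ρ ∧ (ball z ρ ∩ T p).Nonempty}
  have hJ₁u : J₁ ⊆ u := fun p hp => hp.1
  have hJ₂u : J₂ ⊆ u := fun p hp => hp.1
  have hsub : ball z ρ ∩ ⋃ p ∈ u, T p ⊆
      (⋃ p ∈ J₁, ball z ρ ∩ T p) ∪ ⋃ p ∈ J₂, ball z ρ ∩ T p := by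
    rintro x ⟨hx, hxT⟩
    obtain ⟨p, hp, hxp⟩ := mem_iUnion₂.1 hxT
    rcases le_or_gt ρ (infDist p G / 10) with h | h
    · exact Or.inl (mem_iUnion₂.2 ⟨p, ⟨hp, h, x, hx, hxp⟩, hx, hxp⟩)
    · exact Or.inr (mem_iUnion₂.2 ⟨p, ⟨hp, h, x, hx, hxp⟩, hx, hxp⟩)
  have hc₁ : ∀ p ∈ J₁, dist p z < 3 * (infDist p G / 10) ∧ 7 * (infDist p G / 10) < D ∧
      D < 13 * (infDist p G / 10) := by
    rintro p ⟨hp, h, x, hx, hxp⟩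
    exact infDist_mem_Icc_of_whitney (hT p hp hxp) hx h
  have hs : ∀ p ∈ u, 0 < infDist p G / 10 ∧ infDist p G / 10 ≤ r := fun p hp =>
    ⟨by linarith [(hd p hp).1], (hd p hp).2⟩
  have hρk : 0 < ρ ^ k := by positivity
  have h₁ : μ (⋃ p ∈ J₁, ball z ρ ∩ T p) ≤ ENNReal.ofReal (13 ^ k * b' * b / a * ρ ^ k) := by
    rcases J₁.eq_empty_or_nonempty with h0 | ⟨p₀, hp₀⟩
    · simp [h0]
    have hD0 : 0 < D := by linarith [(hc₁ p₀ hp₀).2.1, (hd p₀ hp₀.1).1]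
    -- The factor `(13 / D) ^ k` turns the bound `b' * ρ ^ k` into a multiple of the radius to the
    -- power `k`, as each radius exceeds `D / 13`.
    refine (measure_biUnion_le_of_packing (κ := b' * ρ ^ k * (13 / D) ^ k) ha (by positivity) hH hl
      hu (hJ₁u.trans huH) (fun p hp => hs p hp.1) (hdisj.subset hJ₁u) (z := z) (L := D) hD0
      (fun p hp => ball_subset_ball' ?_) (huc.mono hJ₁u) (fun p hp => ?_)).trans (le_of_eq ?_)
    · linarith [(hc₁ p hp).1, (hc₁ p hp).2.1, (hd p hp.1).1]
    · refine (hTu p hp.1 z ρ hρ).trans (ENNReal.ofReal_le_ofReal ?_)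
      have h1 : 1 ≤ ((13 / D) * (infDist p G / 10)) ^ k := by
        refine Real.one_le_rpow ?_ hk.le
        rw [div_mul_eq_mul_div, le_div_iff₀ hD0]
        linarith [(hc₁ p hp).2.2]
      rw [Real.mul_rpow (by positivity) (hs p hp.1).1.le] at h1
      calc b' * ρ ^ k = b' * ρ ^ k * 1 := (mul_one _).symm
        _ ≤ b' * ρ ^ k * ((13 / D) ^ k * (infDist p G / 10) ^ k) := by gcongr
        _ = _ := by ring
    · have : (13 / D) ^ k * D ^ k = 13 ^ k := by
        rw [← Real.mul_rpow (by positivity) hD0.le]; congr 1; field_simp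
      rw [← this]; congr 1; ring
  have h₂ : μ (⋃ p ∈ J₂, ball z ρ ∩ T p) ≤ ENNReal.ofReal (13 ^ k * b' * b / a * ρ ^ k) := by
    refine (measure_biUnion_le_of_packing (κ := b' * 3 ^ k) ha (by positivity) hH hl
      hu (hJ₂u.trans huH) (fun p hp => hs p hp.1) (hdisj.subset hJ₂u) (z := z) (L := 4 * ρ)
      (by positivity) (fun p hp => ball_subset_ball' ?_) (huc.mono hJ₂u)
      (fun p hp => ?_)).trans (ENNReal.ofReal_le_ofReal ?_)
    · obtain ⟨hp, h, x, hx, hxp⟩ := hp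
      have h1 := mem_closedBall.1 (hT p hp hxp)
      have h2 := mem_ball.1 hx
      have h3 := dist_triangle p x z
      rw [dist_comm p x] at h3
      linarith
    · have h0 := (hs p hp.1).1
      have hsb : ball z ρ ∩ T p ⊆ ball p (3 * (infDist p G / 10)) ∩ T p := fun x hx =>
        ⟨mem_ball.2 ((mem_closedBall.1 (hT p hp.1 hx.2)).trans_lt (by linarith)), hx.2⟩
      refine (measure_mono hsb).trans ((hTu p hp.1 p _ (by linarith)).trans (le_of_eq ?_))
      rw [Real.mul_rpow (by norm_num) h0.le, mul_assoc]
    · have h12 : (3 : ℝ) ^ k * 4 ^ k ≤ 13 ^ k := by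
        rw [← Real.mul_rpow (by norm_num) (by norm_num)]
        exact Real.rpow_le_rpow (by norm_num) (by norm_num) hk.le
      rw [Real.mul_rpow (by norm_num) hρ.le]
      calc b' * 3 ^ k / a * (b * (4 ^ k * ρ ^ k)) = (3 ^ k * 4 ^ k) * (b' * b / a * ρ ^ k) := by ring
        _ ≤ 13 ^ k * (b' * b / a * ρ ^ k) := by gcongr
        _ = _ := by ring
  refine (measure_mono hsub).trans ((measure_union_le _ _).trans ((add_le_add h₁ h₂).trans ?_))
  rw [← ENNReal.ofReal_add (by positivity) (by positivity)]
  exact ENNReal.ofReal_le_ofReal (le_of_eq (by ring))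

/-- Closed sets attached to the Whitney balls accumulate only at `G`. -/
theorem isClosed_union_biUnion_whitney (hk : 0 < k) {a b r : ℝ} (ha : 0 < a)
    {H G u : Set X} {T : X → Set X} (hH : IsClosed H) (hG : IsClosed G) (hGne : G.Nonempty)
    (hl : LowerRegular μ k a r H) (hu : UpperRegular μ k b H) (huH : u ⊆ H)
    (hd : ∀ p ∈ u, 0 < infDist p G ∧ infDist p G / 10 ≤ r)
    (hdisj : u.PairwiseDisjoint fun p => ball p (infDist p G / 10))
    (hT : ∀ p ∈ u, T p ⊆ closedBall p (2 * (infDist p G / 10)))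
    (hTc : ∀ p ∈ u, IsClosed (T p)) :
    IsClosed (G ∪ ⋃ p ∈ u, T p) := by
  refine isClosed_of_closure_subset fun z hz => ?_
  by_cases hzG : z ∈ G
  · exact Or.inl hzG
  have hD0 : 0 < infDist z G := (hG.notMem_iff_infDist_pos hGne).1 hzG
  set D := infDist z G with hD
  -- Near a point off `G` only radii at least `D / 14` occur, and packing allows finitely many of
  -- these; the union is therefore locally finite there.
  let J : Set X := {p | p ∈ u ∧ (ball z (D / 14) ∩ T p).Nonempty}
  have hJu : J ⊆ u := fun p hp => hp.1
  have hJρ : ∀ p ∈ J, D / 14 ≤ infDist p G / 10 := by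
    rintro p ⟨hp, x, hx, hxp⟩
    have h1 := mem_closedBall.1 (hT p hp hxp)
    have h2 := mem_ball.1 hx
    have h4 : infDist x G ≤ infDist p G + dist x p := infDist_le_infDist_add_dist
    have h5 : D ≤ infDist x G + dist z x := infDist_le_infDist_add_dist
    rw [dist_comm z x] at h5
    linarith
  have hJfin : J.Finite := by
    have hfin := ne_top_of_le_ne_top ENNReal.ofReal_ne_top
      (tsum_le_of_packing hH hl hu (hJu.trans huH)
        (fun p hp => ⟨by linarith [(hd p hp.1).1], (hd p hp.1).2⟩)
        (hdisj.subset hJu) (z := z) (L := D) hD0 fun p hp => by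
          obtain ⟨x, hx, hxp⟩ := hp.2
          have := infDist_mem_Icc_of_whitney (hT p hp.1 hxp) hx (hJρ p hp)
          exact ball_subset_ball' (by linarith [(hd p hp.1).1]))
    have hpos : ENNReal.ofReal (a * (D / 14) ^ k) ≠ 0 := (ENNReal.ofReal_pos.2 (by positivity)).ne'
    have h := ENNReal.finite_const_le_of_tsum_ne_top hfin hpos
    have huniv : {p : J | ENNReal.ofReal (a * (D / 14) ^ k) ≤
        ENNReal.ofReal (a * (infDist (p : X) G / 10) ^ k)} = univ := by
      refine eq_univ_of_forall fun p => ENNReal.ofReal_le_ofReal ?_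
      have := hJρ p p.2
      gcongr
    rw [huniv, finite_univ_iff] at h
    exact toFinite J
  have hcl : IsClosed (⋃ p ∈ J, T p) := hJfin.isClosed_biUnion fun p hp => hTc p hp.1
  have hmem : z ∈ closure (⋃ p ∈ J, T p) := by
    rw [Metric.mem_closure_iff] at hz ⊢
    intro ε hε
    obtain ⟨x, hx, hxz⟩ := hz (min ε (D / 14)) (lt_min hε (by positivity))
    have hxD := hxz.trans_le (min_le_right _ _)
    rcases hx with hx | hx
    · have : D ≤ dist z x := infDist_le_dist_of_mem hx
      linarith
    · obtain ⟨p, hp, hxp⟩ := mem_iUnion₂.1 hx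
      exact ⟨x, mem_iUnion₂.2 ⟨p, ⟨hp, x, mem_ball'.2 hxD, hxp⟩, hxp⟩,
        hxz.trans_le (min_le_left _ _)⟩
  rw [hcl.closure_eq] at hmem
  exact Or.inr (biUnion_subset_biUnion_left hJu hmem)

/-- Attaching to `G` pieces in the Whitney balls of its complement. -/
theorem exists_whitney_extension (hk : 0 < k) {a b b' r δ δ' θ C : ℝ} (ha : 0 < a) (hb : 0 < b)
    (hb' : 0 ≤ b') (hr : 0 < r) (hθ : 0 < θ) (hC : 0 ≤ C)
    {H G : Set X} {y : X} (hH : IsClosed H)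
    (hl : LowerRegular μ k a r H) (hu : UpperRegular μ k b H)
    (hyp : ∀ p ∈ H, ∀ s : ℝ, 0 < s → s ≤ r → ∃ T : Set X, IsClosed T ∧ T ⊆ closedBall p (2 * s) ∧
      UpperRegular μ k b' T ∧ HasBigPieces μ k δ' s 𝓕 T ∧
      ENNReal.ofReal (θ * s ^ k) ≤ μ (ball p s ∩ H ∩ T))
    (hG : IsClosed G) (hGy : G ⊆ closedBall y (2 * r)) (hGC : UpperRegular μ k C G)
    (hGP : HasBigPieces μ k δ r 𝓕 G) (hGne : (ball y r ∩ G).Nonempty) :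
    ∃ G' : Set X, G ⊆ G' ∧ IsClosed G' ∧ G' ⊆ closedBall y (2 * r) ∧
      UpperRegular μ k (C + 2 * 13 ^ k * b' * b / a) G' ∧
      HasBigPieces μ k (min (δ / 2 ^ k) (δ' / 100 ^ k)) r 𝓕 G' ∧
      μ (ball y (2 * r) ∩ H ∩ G) + ENNReal.ofReal (θ / (5 ^ k * b)) * μ ((ball y r ∩ H) \ G) ≤
        μ (ball y (2 * r) ∩ H ∩ G') := by
  have hne : G.Nonempty := hGne.mono inter_subset_right
  have hd : ∀ p ∈ (ball y r ∩ H) \ G, 0 < infDist p G ∧ infDist p G < 2 * r := by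
    rintro p ⟨⟨hp, -⟩, hpG⟩
    refine ⟨(hG.notMem_iff_infDist_pos hne).1 hpG, ?_⟩
    obtain ⟨g, hg, hgG⟩ := hGne
    have h1 : infDist p G ≤ dist p g := infDist_le_dist_of_mem hgG
    have h2 := dist_triangle_right p g y
    linarith [mem_ball.1 hp, mem_ball.1 hg]
  obtain ⟨u, huP, huc, hdisj, hcov⟩ := exists_whitney_balls ha hH hl hu hr
    (P := (ball y r ∩ H) \ G) (fun p hp => hp.1.2) (fun p hp => hp.1.1) hd
  have huH : u ⊆ H := fun p hp => (huP hp).1.2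
  have hd' : ∀ p ∈ u, 0 < infDist p G ∧ infDist p G / 10 ≤ r := fun p hp =>
    ⟨(hd p (huP hp)).1, by linarith [(hd p (huP hp)).2]⟩
  have hs : ∀ p ∈ u, 0 < infDist p G / 10 ∧ infDist p G / 10 ≤ r := fun p hp =>
    ⟨by linarith [(hd' p hp).1], (hd' p hp).2⟩
  have hyp' : ∀ p, ∃ T : Set X, p ∈ u → IsClosed T ∧ T ⊆ closedBall p (2 * (infDist p G / 10)) ∧
      UpperRegular μ k b' T ∧ HasBigPieces μ k δ' (infDist p G / 10) 𝓕 T ∧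
      ENNReal.ofReal (θ * (infDist p G / 10) ^ k) ≤ μ (ball p (infDist p G / 10) ∩ H ∩ T) := by
    intro p
    by_cases hp : p ∈ u
    · obtain ⟨T, hT⟩ := hyp p (huH hp) _ (hs p hp).1 (hs p hp).2
      exact ⟨T, fun _ => hT⟩
    · exact ⟨∅, fun h => absurd h hp⟩
  choose T hT using hyp'
  have hTc := fun p hp => (hT p hp).1
  have hTb := fun p hp => (hT p hp).2.1
  have hTu := fun p hp => (hT p hp).2.2.1
  have hTP := fun p hp => (hT p hp).2.2.2.1
  have hTm := fun p hp => (hT p hp).2.2.2.2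
  have hUR := upperRegular_biUnion_whitney hk ha hb' hb.le hH hl hu huH hd' huc hdisj hTb hTu
  refine ⟨G ∪ ⋃ p ∈ u, T p, subset_union_left,
    isClosed_union_biUnion_whitney hk ha hH hG hne hl hu huH hd' hdisj hTb hTc, ?_, ?_, ?_, ?_⟩
  · refine union_subset hGy (iUnion₂_subset fun p hp => (hTb p hp).trans ?_)
    refine closedBall_subset_closedBall' ?_
    linarith [(hd p (huP hp)).2, mem_ball.1 (huP hp).1.1]
  · intro z ρ hρ
    have hK : 0 ≤ 2 * 13 ^ k * b' * b / a := by positivity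
    rw [inter_union_distrib_left, add_mul, ENNReal.ofReal_add (by positivity) (by positivity)]
    exact (measure_union_le _ _).trans (add_le_add (hGC z ρ hρ) (hUR z ρ hρ))
  · intro z hz ρ hρ hρr
    have hρk : 0 < ρ ^ k := by positivity
    -- Used with `c = 100` when the attached piece is large enough at scale `ρ` to supply the big
    -- piece itself. Otherwise `c = 2`: the point is in `G`, or within 13 Whitney radii, hence `13 *
    -- ρ / 100`, of a point of `G`.
    have key : ∀ c ε : ℝ, ∀ w : X, ∀ A : Set X, 0 < c → ∀ F : Set X,
        min (δ / 2 ^ k) (δ' / 100 ^ k) ≤ ε / c ^ k → A ⊆ G ∪ ⋃ p ∈ u, T p →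
        ball w (ρ / c) ⊆ ball z ρ → ENNReal.ofReal (ε * (ρ / c) ^ k) ≤ μ (ball w (ρ / c) ∩ A ∩ F) →
        ENNReal.ofReal (min (δ / 2 ^ k) (δ' / 100 ^ k) * ρ ^ k) ≤
          μ (ball z ρ ∩ (G ∪ ⋃ p ∈ u, T p) ∩ F) := by
      intro c ε w A hc F hε hA hw h
      refine le_trans (ENNReal.ofReal_le_ofReal ?_) (h.trans (measure_mono
        (inter_subset_inter_left F (inter_subset_inter hw hA))))
      rw [Real.div_rpow hρ.le hc.le]
      calc _ ≤ ε / c ^ k * ρ ^ k := by gcongr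
        _ = _ := by ring
    rcases hz with hz | hz
    · obtain ⟨F, hF, h⟩ := hGP z hz (ρ / 2) (by linarith) (by linarith)
      exact ⟨F, hF, key 2 δ z G (by norm_num) F (min_le_left _ _) subset_union_left
        (ball_subset_ball (by linarith)) h⟩
    · obtain ⟨p, hp, hzp⟩ := mem_iUnion₂.1 hz
      rcases le_or_gt (ρ / 100) (infDist p G / 10) with hρp | hρp
      · obtain ⟨F, hF, h⟩ := hTP p hp z hzp (ρ / 100) (by linarith) hρp
        exact ⟨F, hF, key 100 δ' z (T p) (by norm_num) F (min_le_right _ _)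
          ((subset_biUnion_of_mem hp).trans subset_union_right)
          (ball_subset_ball (by linarith)) h⟩
      · have hp0 := (hd' p hp).1
        obtain ⟨g, hg, hpg⟩ := (infDist_lt_iff hne).1
          (show infDist p G < 11 * (infDist p G / 10) by linarith)
        obtain ⟨F, hF, h⟩ := hGP g hg (ρ / 2) (by linarith) (by linarith)
        refine ⟨F, hF, key 2 δ g G (by norm_num) F (min_le_left _ _) subset_union_left
          (ball_subset_ball' ?_) h⟩
        have h1 := mem_closedBall.1 (hTb p hp hzp)
        have h2 := dist_triangle g p z
        rw [dist_comm g p, dist_comm p z] at h2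
        linarith
  · have hTG : ∀ p ∈ u, Disjoint G (ball p (infDist p G / 10)) := by
      refine fun p hp => Set.disjoint_left.2 fun x hxG hx => ?_
      have h1 : infDist p G ≤ dist p x := infDist_le_dist_of_mem hxG
      have h2 := mem_ball'.1 hx
      linarith [(hd' p hp).1]
    have hmeas : ∀ p ∈ u, MeasurableSet (ball p (infDist p G / 10) ∩ H ∩ T p) := fun p hp =>
      (isOpen_ball.measurableSet.inter hH.measurableSet).inter (hTc p hp).measurableSet
    -- The fivefold balls cover the missing part; each has `H`-mass at most `b * 5 ^ k` times the
    -- radius to the power `k`, while the piece in the original ball captures `θ` times that power.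
    have hsum : ENNReal.ofReal (θ / (5 ^ k * b)) * μ ((ball y r ∩ H) \ G) ≤
        μ (⋃ p ∈ u, ball p (infDist p G / 10) ∩ H ∩ T p) := by
      calc _ ≤ ENNReal.ofReal (θ / (5 ^ k * b)) *
            μ (⋃ p ∈ u, ball p (5 * (infDist p G / 10)) ∩ H) := by
            gcongr
            intro x hx
            obtain ⟨q, hq, hxq⟩ := hcov x hx
            exact mem_iUnion₂.2 ⟨q, hq, hxq, hx.1.2⟩
        _ ≤ ENNReal.ofReal (θ / (5 ^ k * b)) *
            ∑' p : u, μ (ball (p : X) (5 * (infDist (p : X) G / 10)) ∩ H) := by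
            gcongr
            exact measure_biUnion_le μ huc _
        _ = ∑' p : u, ENNReal.ofReal (θ / (5 ^ k * b)) *
            μ (ball (p : X) (5 * (infDist (p : X) G / 10)) ∩ H) := ENNReal.tsum_mul_left.symm
        _ ≤ ∑' p : u, μ (ball (p : X) (infDist (p : X) G / 10) ∩ H ∩ T p) := by
            refine ENNReal.tsum_le_tsum fun p => le_trans ?_ (hTm p p.2)
            have h0 := (hs p p.2).1
            refine (mul_le_mul_right (hu p _ (by linarith)) _).trans (le_of_eq ?_)
            rw [← ENNReal.ofReal_mul (by positivity), Real.mul_rpow (by norm_num) h0.le]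
            congr 1; field_simp
        _ = _ := (measure_biUnion huc (fun p hp q hq hpq => (hdisj hp hq hpq).mono
            (inter_subset_left.trans inter_subset_left)
            (inter_subset_left.trans inter_subset_left)) hmeas).symm
    refine (add_le_add_right hsum _).trans ?_
    rw [← measure_union _ (MeasurableSet.biUnion huc hmeas)]
    · refine measure_mono (union_subset (inter_subset_inter_right _ subset_union_left)
        (iUnion₂_subset fun p hp x hx => ⟨⟨?_, hx.1.2⟩, Or.inr (mem_iUnion₂.2 ⟨p, hp, hx.2⟩)⟩))
      refine ball_subset_ball' ?_ hx.1.1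
      linarith [(hd p (huP hp)).2, mem_ball.1 (huP hp).1.1]
    · exact disjoint_iUnion₂_right.2 fun p hp => (hTG p hp).mono inter_subset_right
        (inter_subset_left.trans inter_subset_left)

end Whitney

/-! ### Iterating the extension until little is missing -/

section Approximation

variable {X : Type*} [MetricSpace X] [MeasurableSpace X] [BorelSpace X]
  {μ : Measure X} {k : ℝ} {𝓕 : Set (Set X)}

omit [BorelSpace X] in
theorem HasBigPieces.mono {δ δ' R : ℝ} {G : Set X} (h : HasBigPieces μ k δ R 𝓕 G) (hδ : δ' ≤ δ) :
    HasBigPieces μ k δ' R 𝓕 G := fun z hz ρ hρ hρR => by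
  obtain ⟨F, hF, hm⟩ := h z hz ρ hρ hρR
  exact ⟨F, hF, (ENNReal.ofReal_le_ofReal (by gcongr)).trans hm⟩

/-- After `n` extensions either almost nothing of `H` is left or the captured mass is
proportional to `n`. -/
theorem exists_extension_iterate (hk : 0 < k) {a b b' r δ θ η : ℝ} (ha : 0 < a) (hb : 0 < b)
    (hb' : 0 ≤ b') (hr : 0 < r) (hδ : 0 < δ) (hθ : 0 < θ) (hη : 0 < η)
    {H : Set X} {y : X} (hH : IsClosed H) (hy : y ∈ H)
    (hl : LowerRegular μ k a r H) (hu : UpperRegular μ k b H)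
    (hyp : ∀ p ∈ H, ∀ s : ℝ, 0 < s → s ≤ r → ∃ T : Set X, IsClosed T ∧ T ⊆ closedBall p (2 * s) ∧
      UpperRegular μ k b' T ∧ HasBigPieces μ k δ s 𝓕 T ∧
      ENNReal.ofReal (θ * s ^ k) ≤ μ (ball p s ∩ H ∩ T)) (n : ℕ) :
    ∃ G : Set X, IsClosed G ∧ G ⊆ closedBall y (2 * r) ∧
      UpperRegular μ k (b' + n * (2 * 13 ^ k * b' * b / a)) G ∧
      HasBigPieces μ k (δ / (100 ^ k) ^ n) r 𝓕 G ∧ (ball y r ∩ G).Nonempty ∧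
      (μ ((ball y r ∩ H) \ G) ≤ ENNReal.ofReal (η * r ^ k) ∨
        ENNReal.ofReal (n * (θ / (5 ^ k * b) * (η * r ^ k))) ≤ μ (ball y (2 * r) ∩ H ∩ G)) := by
  induction n with
  | zero =>
    obtain ⟨T, hTc, hTb, hTu, hTP, hTm⟩ := hyp y hy r hr le_rfl
    refine ⟨T, hTc, hTb, by simpa using hTu, by simpa using hTP, ?_, Or.inr (by simp)⟩
    have h0 : 0 < μ (ball y r ∩ H ∩ T) := (ENNReal.ofReal_pos.2 (by positivity)).trans_le hTm
    exact (nonempty_of_measure_ne_zero h0.ne').mono fun x hx => ⟨hx.1.1, hx.2⟩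
  | succ n ih =>
    obtain ⟨G, hGc, hGb, hGu, hGP, hGn, hG⟩ := ih
    obtain ⟨G', hGG', hGc', hGb', hGu', hGP', hm⟩ := exists_whitney_extension hk ha hb hb' hr hθ
      (by positivity) hH hl hu hyp hGc hGb hGu hGP hGn
    refine ⟨G', hGc', hGb', ?_, hGP'.mono ?_, hGn.mono (inter_subset_inter_right _ hGG'), ?_⟩
    · convert hGu' using 1; push_cast; ring
    · have h2 : (2 : ℝ) ^ k ≤ 100 ^ k := Real.rpow_le_rpow (by norm_num) (by norm_num) hk.le
      have h1 : (1 : ℝ) ≤ 100 ^ k := Real.one_le_rpow (by norm_num) hk.le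
      refine le_min ?_ ?_
      · rw [div_div, pow_succ]; gcongr
      · gcongr
        exact le_self_pow₀ h1 n.succ_ne_zero
    -- A small remainder stays small, since `G` only grows; a large one makes the extension gain a
    -- fixed amount.
    · by_cases hle : μ ((ball y r ∩ H) \ G) ≤ ENNReal.ofReal (η * r ^ k)
      · exact Or.inl ((measure_mono (sdiff_subset_sdiff_right hGG')).trans hle)
      · right
        have hG2 := hG.resolve_left hle
        push Not at hle
        refine le_trans ?_ hm
        rw [Nat.cast_succ, add_mul, ENNReal.ofReal_add (by positivity) (by positivity), one_mul,
          ENNReal.ofReal_mul (p := θ / (5 ^ k * b)) (by positivity)]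
        gcongr

/-- All of `H ∩ B(y, r)` up to a small proportion lies in a bounded upper regular set with big
pieces, if all balls centred on `H` contain a big piece of such a set. -/
theorem exists_approximation (hk : 0 < k) {a b b' r δ θ η : ℝ} (ha : 0 < a) (hb : 0 < b)
    (hb' : 0 ≤ b') (hr : 0 < r) (hδ : 0 < δ) (hθ : 0 < θ) (hη : 0 < η)
    {H : Set X} {y : X} (hH : IsClosed H) (hy : y ∈ H)
    (hl : LowerRegular μ k a r H) (hu : UpperRegular μ k b H)
    (hyp : ∀ p ∈ H, ∀ s : ℝ, 0 < s → s ≤ r → ∃ T : Set X, IsClosed T ∧ T ⊆ closedBall p (2 * s) ∧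
      UpperRegular μ k b' T ∧ HasBigPieces μ k δ s 𝓕 T ∧
      ENNReal.ofReal (θ * s ^ k) ≤ μ (ball p s ∩ H ∩ T)) {n : ℕ}
    (hn : b * 2 ^ k < n * (θ / (5 ^ k * b) * η)) :
    ∃ G : Set X, IsClosed G ∧ G ⊆ closedBall y (2 * r) ∧
      UpperRegular μ k (b' + n * (2 * 13 ^ k * b' * b / a)) G ∧
      HasBigPieces μ k (δ / (100 ^ k) ^ n) r 𝓕 G ∧ (ball y r ∩ G).Nonempty ∧
      μ ((ball y r ∩ H) \ G) ≤ ENNReal.ofReal (η * r ^ k) := by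
  obtain ⟨G, hGc, hGb, hGu, hGP, hGn, hG⟩ := exists_extension_iterate hk ha hb hb' hr hδ hθ hη hH hy
    hl hu hyp n
  refine ⟨G, hGc, hGb, hGu, hGP, hGn, hG.resolve_right fun h => ?_⟩
  -- The captured mass cannot exceed `b * (2 * r) ^ k`, which the choice of `n` would force.
  have h1 := h.trans ((measure_mono inter_subset_left).trans (hu y (2 * r) (by positivity)))
  rw [ENNReal.ofReal_le_ofReal_iff (by positivity), Real.mul_rpow (by norm_num) hr.le] at h1
  have hrk : 0 < r ^ k := by positivity
  nlinarith [mul_lt_mul_of_pos_right hn hrk]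

end Approximation

/-! ### From the approximation to the classes `BP` -/

section BigPieces

variable {X : Type*} [MetricSpace X] [MeasurableSpace X] [BorelSpace X] {k : ℝ}

theorem IsADRWith.mono {C C' : ℝ} (hC : 0 < C) (h : C ≤ C') {E : Set X} (hE : IsADRWith k C E) :
    IsADRWith k C' E where
  isClosed := hE.isClosed
  nontrivial := hE.nontrivial
  lower x hx r hr hd := (ENNReal.ofReal_le_ofReal (by gcongr)).trans_lt (hE.lower x hx r hr hd)
  upper x hx r hr := (hE.upper x hx r hr).trans_le (ENNReal.ofReal_le_ofReal (by gcongr))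

theorem IsADRWith.upperRegular {C : ℝ} {E : Set X} (hE : IsADRWith k C E) :
    UpperRegular (Measure.hausdorffMeasure k) k (C * 2 ^ k) E := by
  intro x r hr
  rcases (ball x r ∩ E).eq_empty_or_nonempty with h | ⟨y, hy, hyE⟩
  · simp [h]
  have hsub : ball x r ∩ E ⊆ E ∩ ball y (2 * r) := fun z hz =>
    ⟨hz.2, ball_subset_ball' (by linarith [mem_ball'.1 hy]) hz.1⟩
  refine (measure_mono hsub).trans ((hE.upper y hyE (2 * r) (by linarith)).le.trans (le_of_eq ?_))
  rw [Real.mul_rpow (by norm_num) hr.le, mul_assoc]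

/-- Shrinking radii by `4` carries the lower bound to radii somewhat beyond the diameter, as
`exists_radius_ediam` requires. -/
theorem IsADRWith.lowerRegular {C R : ℝ} {E : Set X} (hE : IsADRWith k C E)
    (hR : ENNReal.ofReal (R / 4) < ediam E) :
    LowerRegular (Measure.hausdorffMeasure k) k (C⁻¹ / 4 ^ k) R E := by
  intro x hx r hr hrR
  have h := hE.lower x hx (r / 4) (by linarith)
    ((ENNReal.ofReal_le_ofReal (by linarith)).trans_lt hR)
  rw [Real.div_rpow hr.le (by norm_num), mul_div_assoc', mul_div_right_comm] at h
  refine h.le.trans (measure_mono fun z hz => ⟨ball_subset_ball (by linarith) hz.2, hz.1⟩)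

omit [MeasurableSpace X] [BorelSpace X] in
-- Lower bounds fail at scales far above the diameter. There `R` is replaced by twice the diameter,
-- which loses no point of `E`.
theorem exists_radius_ediam {E : Set X} (hE : E.Nontrivial) {x : X} (hx : x ∈ E) {R : ℝ}
    (hR : 0 < R) : ∃ R₁, 0 < R₁ ∧ R₁ ≤ R ∧ ball x R ∩ E ⊆ ball x R₁ ∧
      ENNReal.ofReal (R₁ / 4) < ediam E := by
  by_cases h : ENNReal.ofReal (R / 4) < ediam E
  · exact ⟨R, hR, le_rfl, inter_subset_left, h⟩
  · push Not at h
    have hfin : ediam E ≠ ⊤ := ne_top_of_le_ne_top ENNReal.ofReal_ne_top h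
    have hb : Bornology.IsBounded E := Metric.isBounded_iff_ediam_ne_top.2 hfin
    have hpos : 0 < diam E := Metric.diam_pos hE hb
    have hD : ediam E = ENNReal.ofReal (diam E) := (ENNReal.ofReal_toReal hfin).symm
    rw [hD] at h ⊢
    rw [ENNReal.ofReal_le_ofReal_iff (by positivity)] at h
    refine ⟨2 * diam E, by linarith, by linarith, fun z hz => ?_, ?_⟩
    · exact mem_ball.2 ((dist_le_diam_of_mem hb hz.2 hx).trans_lt (by linarith))
    · exact (ENNReal.ofReal_lt_ofReal_iff hpos).2 (by linarith)

/-- Supplies a `t` for which a set with upper constant `C` and mass exceeding `κ * s ^ k` cannot fit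
in a ball of radius `2 * t * s`; large mass thus forces large diameter. -/
theorem exists_small_dilation (hk : 0 < k) {C κ : ℝ} (hC : 0 < C) (hκ : 0 < κ) :
    ∃ t : ℝ, 0 < t ∧ t ≤ 1 ∧ C * (2 * t) ^ k ≤ κ := by
  have hm : 0 < min 1 (κ / C) := by positivity
  refine ⟨(min 1 (κ / C)) ^ k⁻¹ / 2, by positivity, ?_, ?_⟩
  · have := Real.rpow_le_one hm.le (min_le_left _ _) (inv_nonneg.2 hk.le)
    linarith
  · rw [mul_div_cancel₀ _ two_ne_zero, Real.rpow_inv_rpow hm.le hk.ne', mul_comm,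
      ← le_div_iff₀ hC]
    exact min_le_right _ _

/-- A member of `BP(𝓕)` with a large part in a ball of radius `s` has big pieces up to scale
`s`. -/
theorem hasBigPieces_of_mem_BP {c : BPConst} {𝓕 : Set (Set X)} {E : Set X} (hE : E ∈ BP k c 𝓕)
    {κ s t : ℝ} (hs : 0 < s) (ht : 0 < t) (ht1 : t ≤ 1) (htκ : c.C * (2 * t) ^ k ≤ κ)
    (hκ : ENNReal.ofReal (κ * s ^ k) ≤ Measure.hausdorffMeasure k E) :
    HasBigPieces (Measure.hausdorffMeasure k) k (c.θ * c.C⁻¹ * t ^ k) s 𝓕 E := by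
  have hC := c.one_lt_C
  have hθ := c.θ_pos
  have hdiam : ENNReal.ofReal (t * s) < ediam E := by
    by_contra! h
    obtain ⟨e, he⟩ := hE.1.nontrivial.nonempty
    have hsub : E ⊆ E ∩ ball e (2 * t * s) := by
      refine fun x hx => ⟨hx, mem_ball.2 ?_⟩
      have h1 : edist x e ≤ ENNReal.ofReal (t * s) := (edist_le_ediam_of_mem hx he).trans h
      rw [edist_dist, ENNReal.ofReal_le_ofReal_iff (by positivity)] at h1
      nlinarith [mul_pos ht hs]
    have h2 := hκ.trans_lt ((measure_mono hsub).trans_lt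
      (hE.1.upper e he (2 * t * s) (by positivity)))
    rw [Real.mul_rpow (by positivity) hs.le, ← mul_assoc] at h2
    refine absurd h2 (not_lt.2 (ENNReal.ofReal_le_ofReal ?_))
    gcongr
  intro z hz ρ hρ hρs
  obtain ⟨F, hF, hm⟩ := hE.2 z hz (t * ρ) (by positivity)
  have hlow := hE.1.lower z hz (t * ρ) (by positivity)
    ((ENNReal.ofReal_le_ofReal (by gcongr)).trans_lt hdiam)
  refine ⟨F, hF, ?_⟩
  calc ENNReal.ofReal (c.θ * c.C⁻¹ * t ^ k * ρ ^ k)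
      = ENNReal.ofReal c.θ * ENNReal.ofReal (c.C⁻¹ * (t * ρ) ^ k) := by
        rw [← ENNReal.ofReal_mul hθ.le, Real.mul_rpow ht.le hρ.le]
        congr 1; ring
    _ ≤ ENNReal.ofReal c.θ * Measure.hausdorffMeasure k (ball z (t * ρ) ∩ E) := by
        rw [inter_comm]
        exact mul_le_mul_right hlow.le _
    _ ≤ _ := hm
    _ ≤ _ := by
        gcongr
        nlinarith

/-- The constants of a bounded upper regular set with big pieces, as a member of `BP(𝓕)`. -/
noncomputable def bigPiecesConst (k C δ : ℝ) (hC : 0 ≤ C) (hδ : 0 < δ) : BPConst where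
  -- The `2` gives `1 < C` and a strict upper bound; the last term makes the inverse smaller than `δ
  -- / 4 ^ k`, the lower bound obtained at a quarter of the radius.
  C := C + 2 + 2 * 4 ^ k / δ
  θ := δ / (5 ^ k * (C + 1))
  one_lt_C := by
    have : 0 < 2 * 4 ^ k / δ := by positivity
    linarith
  θ_pos := by positivity

theorem mem_BP_of_hasBigPieces (hk : 0 < k) {C δ r : ℝ} (hC : 0 ≤ C) (hδ : 0 < δ) (hr : 0 < r)
    {𝓕 : Set (Set X)} {G : Set X} {y : X} (hG : IsClosed G) (hGy : G ⊆ closedBall y (2 * r))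
    (hGne : G.Nonempty) (hGu : UpperRegular (Measure.hausdorffMeasure k) k C G)
    (hGP : HasBigPieces (Measure.hausdorffMeasure k) k δ r 𝓕 G) :
    G ∈ BP k (bigPiecesConst k C δ hC hδ) 𝓕 := by
  have hdist : ∀ x ∈ G, ∀ z ∈ G, dist x z ≤ 4 * r := fun x hx z hz => by
    have := dist_triangle_right x z y
    linarith [mem_closedBall.1 (hGy hx), mem_closedBall.1 (hGy hz)]
  have hlow : ∀ x ∈ G, ∀ ρ : ℝ, 0 < ρ → ρ ≤ r →
      ENNReal.ofReal (δ * ρ ^ k) ≤ Measure.hausdorffMeasure k (ball x ρ ∩ G) := by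
    intro x hx ρ hρ hρr
    obtain ⟨F, -, h⟩ := hGP x hx ρ hρ hρr
    exact h.trans (measure_mono inter_subset_left)
  have h4 : 0 < 2 * (4 : ℝ) ^ k / δ := by positivity
  refine ⟨⟨hG, ?_, ?_, ?_⟩, ?_⟩
  · by_contra hnt
    rw [not_nontrivial_iff] at hnt
    obtain ⟨z, hz⟩ := hGne
    -- A single point would carry mass `δ * r ^ k` in a ball too small for it.
    obtain ⟨t, ht, -, htC⟩ := exists_small_dilation hk (C := C + 1) (by linarith) hδ
    have hsub : ball z r ∩ G ⊆ ball z (2 * t * r) ∩ G := fun x hx =>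
      ⟨by rw [hnt hx.2 hz]; exact mem_ball_self (by positivity), hx.2⟩
    have h := (hlow z hz r hr le_rfl).trans ((measure_mono hsub).trans (hGu z _ (by positivity)))
    rw [ENNReal.ofReal_le_ofReal_iff (by positivity), Real.mul_rpow (by positivity) hr.le] at h
    have hrk : 0 < r ^ k := by positivity
    have htk : 0 < (2 * t) ^ k := by positivity
    nlinarith [mul_pos htk hrk]
  · intro x hx ρ hρ hρd
    have hρ4 : ρ < 4 * r := by
      have h : ediam G ≤ ENNReal.ofReal (4 * r) := ediam_le fun p hp q hq => by
        rw [edist_dist]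
        exact ENNReal.ofReal_le_ofReal (hdist p hp q hq)
      exact (ENNReal.ofReal_lt_ofReal_iff (by positivity)).1 (hρd.trans_le h)
    have h := hlow x hx (ρ / 4) (by linarith) (by linarith)
    have hsub : ball x (ρ / 4) ∩ G ⊆ G ∩ ball x ρ := fun z hz =>
      ⟨hz.2, ball_subset_ball (by linarith) hz.1⟩
    refine lt_of_lt_of_le ?_ (h.trans (measure_mono hsub))
    rw [ENNReal.ofReal_lt_ofReal_iff (by positivity), Real.div_rpow hρ.le (by norm_num),
      ← mul_div_assoc, mul_div_right_comm]
    gcongr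
    change (C + 2 + 2 * 4 ^ k / δ)⁻¹ < δ / 4 ^ k
    rw [inv_lt_comm₀ (by positivity) (by positivity), inv_div]
    have : 2 * (4 : ℝ) ^ k / δ = 4 ^ k / δ + 4 ^ k / δ := by ring
    have h4' : 0 < (4 : ℝ) ^ k / δ := by positivity
    linarith
  · intro x _ ρ hρ
    rw [inter_comm]
    refine (hGu x ρ hρ).trans_lt ?_
    have hρk : 0 < ρ ^ k := by positivity
    change _ < ENNReal.ofReal ((C + 2 + 2 * 4 ^ k / δ) * ρ ^ k)
    rw [ENNReal.ofReal_lt_ofReal_iff (by positivity)]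
    gcongr
    linarith
  · intro z hz ρ hρ
    -- `G` has diameter at most `4 * r`, so radii above `5 * r` see nothing new; a fifth of the
    -- capped radius is within the range of the big pieces.
    have hm : 0 < min ρ (5 * r) := lt_min hρ (by linarith)
    obtain ⟨F, hF, h⟩ := hGP z hz (min ρ (5 * r) / 5) (by positivity)
      (by linarith [min_le_right ρ (5 * r)])
    have hsub : ball z ρ ∩ G ⊆ ball z (min ρ (5 * r)) ∩ G := fun x hx =>
      ⟨mem_ball.2 (lt_min hx.1 ((hdist x hx.2 z hz).trans_lt (by linarith))), hx.2⟩
    refine ⟨F, hF, ?_⟩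
    change ENNReal.ofReal (δ / (5 ^ k * (C + 1))) * _ ≤ _
    calc _ ≤ ENNReal.ofReal (δ / (5 ^ k * (C + 1))) * ENNReal.ofReal (C * min ρ (5 * r) ^ k) :=
          mul_le_mul_right ((measure_mono hsub).trans (hGu z _ hm)) _
      _ ≤ ENNReal.ofReal (δ * (min ρ (5 * r) / 5) ^ k) := by
          rw [← ENNReal.ofReal_mul (by positivity)]
          refine ENNReal.ofReal_le_ofReal ?_
          rw [Real.div_rpow hm.le (by norm_num)]
          have : 0 < min ρ (5 * r) ^ k := by positivity
          calc _ = δ * (min ρ (5 * r) ^ k / 5 ^ k) * (C / (C + 1)) := by field_simp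
            _ ≤ δ * (min ρ (5 * r) ^ k / 5 ^ k) * 1 := by
                gcongr
                exact div_le_one_of_le₀ (by linarith) (by linarith)
            _ = _ := mul_one _
      _ ≤ _ := h
      _ ≤ _ := by
          gcongr
          linarith [min_le_left ρ (5 * r)]

/-- Three applications of the big-pieces operator reduce to two. -/
theorem exists_BP_BP_BP_subset (hk : 0 < k) (c₁ c₂ c₃ : BPConst) : ∃ d₁ d₂ : BPConst,
    ∀ (X : Type u) [MetricSpace X] [MeasurableSpace X] [BorelSpace X] (𝓕 : Set (Set X)),
      BP k c₁ (BP k c₂ (BP k c₃ 𝓕)) ⊆ BP k d₁ (BP k d₂ 𝓕) := by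
  have hC₁ : 0 < c₁.C := zero_lt_one.trans c₁.one_lt_C
  have hC₂ : 0 < c₂.C := zero_lt_one.trans c₂.one_lt_C
  have hC₃ : 0 < c₃.C := zero_lt_one.trans c₃.one_lt_C
  have hθ₁ := c₁.θ_pos
  have hθ₂ := c₂.θ_pos
  have hθ₃ := c₃.θ_pos
  obtain ⟨a, ha⟩ : ∃ a, a = c₂.C⁻¹ / 4 ^ k := ⟨_, rfl⟩
  obtain ⟨b, hb⟩ : ∃ b, b = c₂.C * 2 ^ k := ⟨_, rfl⟩
  obtain ⟨b', hb'⟩ : ∃ b', b' = c₃.C * 2 ^ k := ⟨_, rfl⟩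
  obtain ⟨θ, hθ⟩ : ∃ θ, θ = c₂.θ * a := ⟨_, rfl⟩
  have ha0 : 0 < a := by rw [ha]; positivity
  have hb0 : 0 < b := by rw [hb]; positivity
  have hb'0 : 0 < b' := by rw [hb']; positivity
  have hθ0 : 0 < θ := by rw [hθ]; positivity
  obtain ⟨t, ht, ht1, htC⟩ := exists_small_dilation hk hC₃ hθ0
  obtain ⟨δ, hδ⟩ : ∃ δ, δ = c₃.θ * c₃.C⁻¹ * t ^ k / 16 ^ k := ⟨_, rfl⟩
  have hδ0 : 0 < δ := by rw [hδ]; positivity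
  -- Chosen so that the loss `η * (2 * R₁) ^ k` is `c₁.θ / 2` times the lower bound for the mass of
  -- `E` in the ball; `2 * R₁` appears on recentring at a point of `H`.
  obtain ⟨η, hη⟩ : ∃ η, η = c₁.θ / 2 * (c₁.C⁻¹ / 4 ^ k) / 2 ^ k := ⟨_, rfl⟩
  have hη0 : 0 < η := by rw [hη]; positivity
  obtain ⟨n, hn⟩ : ∃ n : ℕ, b * 2 ^ k < n * (θ / (5 ^ k * b) * η) := by
    obtain ⟨n, hn⟩ := exists_nat_gt (b * 2 ^ k / (θ / (5 ^ k * b) * η))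
    exact ⟨n, (div_lt_iff₀ (by positivity)).1 hn⟩
  refine ⟨⟨c₁.C, c₁.θ / 2, c₁.one_lt_C, half_pos hθ₁⟩,
    bigPiecesConst k (b' + n * (2 * 13 ^ k * b' * b / a)) (δ / (100 ^ k) ^ n) (by positivity)
      (by positivity), ?_⟩
  intro X _ _ _ 𝓕 E hE
  refine ⟨hE.1, fun x hx R hR => ?_⟩
  obtain ⟨H, hH, hHm⟩ := hE.2 x hx R hR
  obtain ⟨R₁, hR₁, hR₁R, hER₁, hR₁d⟩ := exists_radius_ediam hE.1.nontrivial hx hR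
  have hElow : ENNReal.ofReal (c₁.C⁻¹ / 4 ^ k * R₁ ^ k) ≤
      Measure.hausdorffMeasure k (ball x R ∩ E) :=
    (hE.1.lowerRegular hR₁d x hx R₁ hR₁ le_rfl).trans
      (measure_mono (inter_subset_inter_left _ (ball_subset_ball hR₁R)))
  have hA0 : 0 < Measure.hausdorffMeasure k (ball x R ∩ E ∩ H) := by
    refine lt_of_lt_of_le ?_ hHm
    exact ENNReal.mul_pos (ENNReal.ofReal_pos.2 hθ₁).ne'
      ((ENNReal.ofReal_pos.2 (by positivity)).trans_le hElow).ne'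
  obtain ⟨y, hyE, hyH⟩ := nonempty_of_measure_ne_zero hA0.ne'
  obtain ⟨r, hr, hrR, hHr, hrd⟩ := exists_radius_ediam hH.1.nontrivial hyH
    (show 0 < 2 * R₁ by linarith)
  have hAsub : ball x R ∩ E ∩ H ⊆ ball y r ∩ H := by
    refine fun z hz => ⟨hHr ⟨?_, hz.2⟩, hz.2⟩
    have h1 := mem_ball.1 (hER₁ hz.1)
    have h2 := mem_ball.1 (hER₁ hyE)
    have h3 := dist_triangle_right z y x
    exact mem_ball.2 (by linarith)
  have hlow := hH.1.lowerRegular hrd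
  have hup := hH.1.upperRegular
  rw [← ha] at hlow
  rw [← hb] at hup
  have hyp : ∀ p ∈ H, ∀ s : ℝ, 0 < s → s ≤ r → ∃ T : Set X, IsClosed T ∧
      T ⊆ closedBall p (2 * s) ∧ UpperRegular (Measure.hausdorffMeasure k) k b' T ∧
      HasBigPieces (Measure.hausdorffMeasure k) k δ s 𝓕 T ∧
      ENNReal.ofReal (θ * s ^ k) ≤ Measure.hausdorffMeasure k (ball p s ∩ H ∩ T) := by
    intro p hp s hs hsr
    obtain ⟨E', hE', hm⟩ := hH.2 p hp s hs
    have hm' : ENNReal.ofReal (θ * s ^ k) ≤ Measure.hausdorffMeasure k (ball p s ∩ H ∩ E') := by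
      refine le_trans ?_ hm
      rw [hθ, mul_assoc, ENNReal.ofReal_mul hθ₂.le]
      exact mul_le_mul_right (hlow p hp s hs hsr) _
    obtain ⟨T, hTc, hTE, hTb, hTs, hTP⟩ := exists_truncation hs hE'.1.isClosed
      (hasBigPieces_of_mem_BP hE' hs ht ht1 htC (hm'.trans (measure_mono inter_subset_right))) p
    refine ⟨T, hTc, hTb, (hb' ▸ hE'.1.upperRegular).mono hTE, hδ ▸ hTP, hm'.trans (measure_mono ?_)⟩
    exact fun z hz => ⟨hz.1, hTs ⟨hz.1.1, hz.2⟩⟩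
  obtain ⟨G, hGc, hGb, hGu, hGP, hGn, hGm⟩ := exists_approximation hk ha0 hb0 hb'0.le hr hδ0 hθ0 hη0
    hH.1.isClosed hyH hlow hup hyp hn
  refine ⟨G, mem_BP_of_hasBigPieces hk _ _ hr hGc hGb (hGn.mono inter_subset_right) hGu hGP, ?_⟩
  have hhalf : ENNReal.ofReal c₁.θ = ENNReal.ofReal (c₁.θ / 2) + ENNReal.ofReal (c₁.θ / 2) := by
    rw [← ENNReal.ofReal_add (by positivity) (by positivity), add_halves]
  have hsmall : Measure.hausdorffMeasure k ((ball y r ∩ H) \ G) ≤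
      ENNReal.ofReal (c₁.θ / 2) * Measure.hausdorffMeasure k (ball x R ∩ E) := by
    refine hGm.trans (le_trans ?_ (mul_le_mul_right hElow _))
    rw [← ENNReal.ofReal_mul (by positivity)]
    refine ENNReal.ofReal_le_ofReal ?_
    calc η * r ^ k ≤ η * (2 * R₁) ^ k := by gcongr
      _ = _ := by rw [hη, Real.mul_rpow (by norm_num) hR₁.le]; field_simp
  have hfin : ENNReal.ofReal (c₁.θ / 2) * Measure.hausdorffMeasure k (ball x R ∩ E) ≠ ⊤ := by
    refine ENNReal.mul_ne_top ENNReal.ofReal_ne_top ?_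
    exact ne_top_of_le_ne_top ENNReal.ofReal_ne_top (hE.1.upperRegular x R hR)
  change ENNReal.ofReal (c₁.θ / 2) * _ ≤ _
  rw [hhalf, add_mul] at hHm
  -- Half of the captured mass pays for what `G` misses of `H`; finiteness permits cancelling it.
  refine ENNReal.le_of_add_le_add_right hfin (hHm.trans ?_)
  refine (measure_mono (t := (ball x R ∩ E ∩ G) ∪ ((ball y r ∩ H) \ G)) fun z hz => ?_).trans
    ((measure_union_le _ _).trans (add_le_add_right hsmall _))
  by_cases hzG : z ∈ G
  · exact Or.inl ⟨hz.1, hzG⟩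
  · exact Or.inr ⟨hAsub hz, hzG⟩

theorem BP_mono (c : BPConst) {𝓕 𝓖 : Set (Set X)} (h : 𝓕 ⊆ 𝓖) : BP k c 𝓕 ⊆ BP k c 𝓖 :=
  fun _ hE => ⟨hE.1, fun x hx R hR => (hE.2 x hx R hR).imp fun _ hG => ⟨h hG.1, hG.2⟩⟩

theorem BP_subset_BP {c d : BPConst} (hC : c.C ≤ d.C) (hθ : d.θ ≤ c.θ) (𝓕 : Set (Set X)) :
    BP k c 𝓕 ⊆ BP k d 𝓕 := fun _ hE =>
  ⟨hE.1.mono (zero_lt_one.trans c.one_lt_C) hC, fun x hx R hR =>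
    (hE.2 x hx R hR).imp fun _ hG => ⟨hG.1, le_trans (by gcongr) hG.2⟩⟩

theorem mem_BP_of_mem {c : BPConst} (hθ : c.θ ≤ 1) {𝓕 : Set (Set X)} {E : Set X} (hE : E ∈ 𝓕)
    (h : IsADRWith k c.C E) : E ∈ BP k c 𝓕 := by
  refine ⟨h, fun x _ R _ => ⟨E, hE, ?_⟩⟩
  rw [inter_assoc, inter_self]
  exact mul_le_of_le_one_left' (ENNReal.ofReal_le_one.2 hθ)

theorem exists_BPIter_subset (hk : 0 < k) (n : ℕ) (c : Fin (n + 2) → BPConst) :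
    ∃ c₁ c₂ : BPConst,
      ∀ (X : Type u) [MetricSpace X] [MeasurableSpace X] [BorelSpace X] (𝓕 : Set (Set X)),
        BPIter k (n + 2) c 𝓕 ⊆ BP k c₁ (BP k c₂ 𝓕) := by
  induction n with
  | zero => exact ⟨c 0, c 1, fun X _ _ _ 𝓕 => Subset.rfl⟩
  | succ n ih =>
    obtain ⟨d₁, d₂, hd⟩ := ih fun i => c i.succ
    obtain ⟨e₁, e₂, he⟩ := exists_BP_BP_BP_subset.{u} hk (c 0) d₁ d₂
    exact ⟨e₁, e₂, fun X _ _ _ 𝓕 => (BP_mono (c 0) (hd X 𝓕)).trans (he X 𝓕)⟩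

/-- The two innermost operators of `c` absorb `c₁` and `c₂`; each further one is passed by taking
the set as its own big piece, which requires regularity with that operator's constant too. -/
theorem BP_BP_subset_BPIter (n : ℕ) (c : Fin (n + 2) → BPConst) (hθ : ∀ i, (c i).θ ≤ 1)
    {c₁ c₂ : BPConst} (h₁ : ∀ i, c₁.C ≤ (c i).C) (h₁' : (c (Fin.last n).castSucc).θ ≤ c₁.θ)
    (h₂ : c₂.C ≤ (c (Fin.last (n + 1))).C) (h₂' : (c (Fin.last (n + 1))).θ ≤ c₂.θ)
    (𝓕 : Set (Set X)) : BP k c₁ (BP k c₂ 𝓕) ⊆ BPIter k (n + 2) c 𝓕 := by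
  induction n with
  | zero => exact (BP_subset_BP (h₁ 0) h₁' _).trans (BP_mono _ (BP_subset_BP h₂ h₂' _))
  | succ n ih =>
    have h := ih (fun i => c i.succ) (fun i => hθ _) (fun i => h₁ _) h₁' h₂ h₂'
    exact fun E hE => mem_BP_of_mem (hθ 0) (h hE)
      (hE.1.mono (zero_lt_one.trans c₁.one_lt_C) (h₁ 0))

end BigPieces

theorem corollary1 (k : ℝ) (hk : 0 < k) (j : ℕ) (hj : 2 < j) :
    -- the families agree
    (∀ (X : Type u) [MetricSpace X] [MeasurableSpace X] [BorelSpace X] (𝓕 : Set (Set X)),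
      (∀ G ∈ 𝓕, IsADR k G) →
      {E : Set X | ∃ c : Fin j → BPConst, E ∈ BPIter k j c 𝓕} =
        {E : Set X | ∃ c₁ c₂ : BPConst, E ∈ BP k c₁ (BP k c₂ 𝓕)}) ∧
    -- with constants that depend only on `k`, `j` and the given constants
    (∀ c : Fin j → BPConst, ∃ c₁ c₂ : BPConst,
      ∀ (X : Type u) [MetricSpace X] [MeasurableSpace X] [BorelSpace X] (𝓕 : Set (Set X)),
        (∀ G ∈ 𝓕, IsADR k G) → BPIter k j c 𝓕 ⊆ BP k c₁ (BP k c₂ 𝓕)) ∧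
    (∀ c₁ c₂ : BPConst, ∃ c : Fin j → BPConst,
      ∀ (X : Type u) [MetricSpace X] [MeasurableSpace X] [BorelSpace X] (𝓕 : Set (Set X)),
        (∀ G ∈ 𝓕, IsADR k G) → BP k c₁ (BP k c₂ 𝓕) ⊆ BPIter k j c 𝓕) ∧
    (∀ c : Fin j → BPConst, (∀ i, (c i).θ ≤ 1) →
      ∃ c₁ c₂ : BPConst, c₁.θ ≤ 1 ∧ c₂.θ ≤ 1 ∧
      ∀ (X : Type u) [MetricSpace X] [MeasurableSpace X] [BorelSpace X] (𝓕 : Set (Set X)),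
        (∀ G ∈ 𝓕, IsADR k G) → BP k c₁ (BP k c₂ 𝓕) ⊆ BPIter k j c 𝓕) := by
  obtain ⟨n, rfl⟩ := Nat.exists_eq_add_of_le' hj.le
  have hle : ∀ c : Fin (n + 2) → BPConst, ∃ c₁ c₂ : BPConst,
      ∀ (X : Type u) [MetricSpace X] [MeasurableSpace X] [BorelSpace X] (𝓕 : Set (Set X)),
        (∀ G ∈ 𝓕, IsADR k G) → BPIter k (n + 2) c 𝓕 ⊆ BP k c₁ (BP k c₂ 𝓕) := fun c => by
    obtain ⟨c₁, c₂, h⟩ := exists_BPIter_subset.{u} hk n c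
    exact ⟨c₁, c₂, fun X _ _ _ 𝓕 _ => h X 𝓕⟩
  have hge : ∀ c₁ c₂ : BPConst, ∃ c : Fin (n + 2) → BPConst,
      ∀ (X : Type u) [MetricSpace X] [MeasurableSpace X] [BorelSpace X] (𝓕 : Set (Set X)),
        (∀ G ∈ 𝓕, IsADR k G) → BP k c₁ (BP k c₂ 𝓕) ⊆ BPIter k (n + 2) c 𝓕 := fun c₁ c₂ =>
    ⟨fun _ => ⟨max c₁.C c₂.C, min 1 (min c₁.θ c₂.θ), lt_max_of_lt_left c₁.one_lt_C,
      lt_min one_pos (lt_min c₁.θ_pos c₂.θ_pos)⟩, fun X _ _ _ 𝓕 _ =>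
      BP_BP_subset_BPIter n _ (fun _ => min_le_left _ _) (fun _ => le_max_left _ _)
        ((min_le_right _ _).trans (min_le_left _ _)) (le_max_right _ _)
        ((min_le_right _ _).trans (min_le_right _ _)) 𝓕⟩
  refine ⟨fun X _ _ _ 𝓕 h𝓕 => Set.ext fun E => ⟨?_, ?_⟩, hle, hge, fun c hc => ?_⟩
  · rintro ⟨c, hE⟩
    obtain ⟨c₁, c₂, h⟩ := hle c
    exact ⟨c₁, c₂, h X 𝓕 h𝓕 hE⟩
  · rintro ⟨c₁, c₂, hE⟩
    obtain ⟨c, h⟩ := hge c₁ c₂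
    exact ⟨c, h X 𝓕 h𝓕 hE⟩
  -- The outer set must be regular with every constant of `c`, hence the smallest; the fraction `1`
  -- dominates every `θ`.
  · obtain ⟨i₀, hi₀⟩ := Finite.exists_min fun i => (c i).C
    exact ⟨⟨(c i₀).C, 1, (c i₀).one_lt_C, one_pos⟩, c (Fin.last (n + 1)), le_rfl, hc _,
      fun X _ _ _ 𝓕 _ => BP_BP_subset_BPIter n c hc (c₁ := ⟨(c i₀).C, 1, (c i₀).one_lt_C, one_pos⟩) hi₀ (hc _)
        le_rfl le_rfl 𝓕⟩
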